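/- An interior algebra is a Boolean algebra with an operation $\Box$ such that $\Box 1=1$, $\Box(a\wedge b)=\Box a\wedge\Box b$, $\Box a\le a$ and $\Box a\le\Box\Box a$; an element $a$ is open if $\Box a=a$. Formulas are built from propositional variables by $\wedge,\vee,\to,\neg,\Box$; a formula is valid in an algebra if it takes the value $1$ under every valuation, and the variety defined (axiomatized) by a set $\Gamma$ of formulas is the class of all interior algebras in which every formula of $\Gamma$ is valid. We write $A\Rrightarrow B$ for $\Box A\to\Box B$. The opremum of a subdirectly irreducible interior algebra is its greatest open element different from $1$. Let $\mathcal M$ be a variety of interior algebras. A formula $A(p_1,\dots,p_n)$ and a valuation $\nu$ in an algebra $\mathfrak A$ define $\mathfrak A$ over $\mathcal M$ if $\nu(p_1),\dots,\nu(p_n)$ generate $\mathfrak A$, $\nu(A)=1$, and for every formula $B(p_1,\dots,p_n)$ with $\nu(B)=1$ the formula $A\Rrightarrow B$ is valid in all algebras of $\mathcal M$. If moreover $\mathfrak A\in\mathcal M$ is subdirectly irreducible and $B(p_1,\dots,p_n)$ is a formula for which $\nu(B)$ is the opremum of $\mathfrak A$, then $A\Rrightarrow B$ is called a characteristic formula of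 $\mathfrak A$ over $\mathcal M$. For a finite subdirectly irreducible interior algebra $\mathfrak A=\{a_1,\dots,a_n\}$ with opremum $a_k$, the Jankov formula of $\mathfrak A$ is $D\Rrightarrow p_k$, where $D(p_1,\dots,p_n)$ is the diagram formula of $\mathfrak A$, i.e. the conjunction of all formulas $(p_i\circ p_j)\leftrightarrow p_l$ with $a_i\circ a_j=a_l$, $\circ\in\{\wedge,\vee,\to\}$, and all formulas $\neg p_i\leftrightarrow p_l$ with $\neg a_i=a_l$ and $\Box p_i\leftrightarrow p_l$ with $\Box a_i=a_l$. Theorem. There is a continuum of varieties of interior algebras that are defined by characteristic formulas but cannot be axiomatized by Jankov formulas. More precisely, there is a variety $\mathcal M$ of interior algebras such that the set of those varieties of interior algebras that are defined by a set of characteristic formulas, over $\mathcal M$, of infinite algebras, but are not defined by any set of Jankov formulas, has cardinality $2^{\aleph_0}$. -/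

import Mathlib

universe u

/-- Interior algebras (topological Boolean algebras, `S4`-algebras): a Boolean algebra with an
interior operator. The one-element algebra is allowed. -/
class InteriorAlgebra (α : Type u) extends BooleanAlgebra α where
  box : α → α
  box_top : box ⊤ = ⊤
  box_inf : ∀ a b : α, box (a ⊓ b) = box a ⊓ box b
  box_le : ∀ a : α, box a ≤ a
  box_le_box_box : ∀ a : α, box a ≤ box (box a)

namespace InteriorAlgebra

/-- A bundled interior algebra. -/
structure Alg : Type (u + 1) where
  carrier : Type u
  [str : InteriorAlgebra carrier]

instance : CoeSort Alg.{u} (Type u) := ⟨Alg.carrier⟩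

instance (𝔄 : Alg.{u}) : InteriorAlgebra 𝔄 := 𝔄.str

/-! ### Congruences, subdirect irreducibility, generation -/

/-- Congruences of an interior algebra. -/
structure IsCongruence {α : Type u} [InteriorAlgebra α] (r : Setoid α) : Prop where
  inf : ∀ a b c d, r a b → r c d → r (a ⊓ c) (b ⊓ d)
  sup : ∀ a b c d, r a b → r c d → r (a ⊔ c) (b ⊔ d)
  himp : ∀ a b c d, r a b → r c d → r (a ⇨ c) (b ⇨ d)
  compl : ∀ a b, r a b → r aᶜ bᶜ
  box : ∀ a b, r a b → r (box a) (box b)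

/-- Subdirect irreducibility: there is a least congruence among those different from the identity
relation (so a one-element algebra is not subdirectly irreducible). -/
def IsSubdirectlyIrreducible (α : Type u) [InteriorAlgebra α] : Prop :=
  ∃ μ : Setoid α, IsCongruence μ ∧ μ ≠ ⊥ ∧
    ∀ θ : Setoid α, IsCongruence θ → θ ≠ ⊥ → μ ≤ θ

/-- `S` is the universe of a subalgebra (if it is nonempty). -/
structure IsSubuniverse {α : Type u} [InteriorAlgebra α] (S : Set α) : Prop where
  inf : ∀ a ∈ S, ∀ b ∈ S, a ⊓ b ∈ S
  sup : ∀ a ∈ S, ∀ b ∈ S, a ⊔ b ∈ S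
  himp : ∀ a ∈ S, ∀ b ∈ S, a ⇨ b ∈ S
  compl : ∀ a ∈ S, aᶜ ∈ S
  box : ∀ a ∈ S, box a ∈ S

/-- The set `G` generates the whole algebra. -/
def Generates {α : Type u} [InteriorAlgebra α] (G : Set α) : Prop :=
  ∀ S : Set α, IsSubuniverse S → G ⊆ S → S = Set.univ

/-- `b` is the opremum of the Heyting algebra of open elements: the greatest element among the
open elements different from `⊤`. -/
def IsOpremum {α : Type u} [InteriorAlgebra α] (b : α) : Prop :=
  IsGreatest {a : α | box a = a ∧ a ≠ ⊤} b

/-! ### Modal formulas, validity, varieties -/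

/-- Modal formulas in the signature `∧, ∨, →, ¬, □`, with variables `p₀, p₁, …`. -/
inductive Formula : Type
  | var : ℕ → Formula
  | and : Formula → Formula → Formula
  | or : Formula → Formula → Formula
  | imp : Formula → Formula → Formula
  | neg : Formula → Formula
  | box : Formula → Formula

namespace Formula

/-- The set of variables that occur in a formula. -/
def vars : Formula → Finset ℕ
  | var i => {i}
  | and φ ψ => φ.vars ∪ ψ.vars
  | or φ ψ => φ.vars ∪ ψ.vars
  | imp φ ψ => φ.vars ∪ ψ.vars
  | neg φ => φ.vars
  | box φ => φ.vars

/-- The value of a formula under a valuation. -/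
def eval {α : Type u} [InteriorAlgebra α] (ν : ℕ → α) : Formula → α
  | var i => ν i
  | and φ ψ => φ.eval ν ⊓ ψ.eval ν
  | or φ ψ => φ.eval ν ⊔ ψ.eval ν
  | imp φ ψ => φ.eval ν ⇨ ψ.eval ν
  | neg φ => (φ.eval ν)ᶜ
  | box φ => InteriorAlgebra.box (φ.eval ν)

/-- `φ ↔ ψ`. -/
def iff (φ ψ : Formula) : Formula := and (imp φ ψ) (imp ψ φ)

/-- The implication `□φ → □ψ`. -/
def boxImp (φ ψ : Formula) : Formula := imp (box φ) (box ψ)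

/-- The conjunction of a list of formulas (a tautology if the list is empty). -/
def conj : List Formula → Formula
  | [] => imp (var 0) (var 0)
  | [φ] => φ
  | φ :: ψ :: l => and φ (conj (ψ :: l))

end Formula

/-- `𝔄 ⊨ φ`. -/
def Valid (𝔄 : Alg.{u}) (φ : Formula) : Prop := ∀ ν : ℕ → 𝔄, φ.eval ν = ⊤

/-- The class of all interior algebras in which all formulas of `Γ` are valid. -/
def Mod (Γ : Set Formula) : Set Alg.{u} := {𝔄 | ∀ φ ∈ Γ, Valid 𝔄 φ}

/-- Varieties of interior algebras, as equational classes; an equation `φ = ψ` amounts to the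
validity of the formula `φ ↔ ψ`, and the validity of `φ` to the equation `φ = (φ → φ)`. -/
def IsVariety (M : Set Alg.{u}) : Prop := ∃ Γ : Set Formula, M = Mod Γ

/-! ### Finite presentations and characteristic formulas -/

/-- The pair `(φ, ν)` defines the algebra `𝔄` over `M`, in the finitely many variables of `P`. -/
structure Defines (M : Set Alg.{u}) (𝔄 : Alg.{u}) (P : Finset ℕ) (φ : Formula) (ν : ℕ → 𝔄) :
    Prop where
  vars_subset : φ.vars ⊆ P
  generates : Generates (ν '' (P : Set ℕ))
  eval_eq_top : φ.eval ν = ⊤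
  derives : ∀ ψ : Formula, ψ.vars ⊆ P → ψ.eval ν = ⊤ → ∀ 𝔅 ∈ M, Valid 𝔅 (φ.boxImp ψ)

/-- `χ` is a characteristic formula over `M` of the algebra `𝔄`, a subdirectly irreducible member
of `M` that is finitely presentable over `M`. -/
def IsCharacteristicFormula (M : Set Alg.{u}) (𝔄 : Alg.{u}) (χ : Formula) : Prop :=
  𝔄 ∈ M ∧ IsSubdirectlyIrreducible 𝔄 ∧
    ∃ (P : Finset ℕ) (φ ψ : Formula) (ν : ℕ → 𝔄),
      Defines M 𝔄 P φ ν ∧ ψ.vars ⊆ P ∧ IsOpremum (ψ.eval ν) ∧ χ = φ.boxImp ψ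

/-! ### Jankov formulas -/

/-- The diagram formula of a finite interior algebra with the enumeration
`e 0, …, e (n - 1)` of its elements; the variable `pᵢ` stands for the element `e i`. -/
def diagram {α : Type u} [InteriorAlgebra α] {n : ℕ} (e : Fin n ≃ α) : Formula :=
  let p : α → Formula := fun a => .var (e.symm a)
  let elems : List α := (List.finRange n).map e
  .conj
    ((elems ×ˢ elems).map (fun x => .iff (.and (p x.1) (p x.2)) (p (x.1 ⊓ x.2))) ++
     (elems ×ˢ elems).map (fun x => .iff (.or (p x.1) (p x.2)) (p (x.1 ⊔ x.2))) ++
     (elems ×ˢ elems).map (fun x => .iff (.imp (p x.1) (p x.2)) (p (x.1 ⇨ x.2))) ++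
     elems.map (fun a => .iff (.neg (p a)) (p aᶜ)) ++
     elems.map (fun a => .iff (.box (p a)) (p (InteriorAlgebra.box a))))

/-- `χ` is a Jankov formula of the finite subdirectly irreducible interior algebra `𝔄`. -/
def IsJankovFormulaOf (𝔄 : Alg.{u}) (χ : Formula) : Prop :=
  IsSubdirectlyIrreducible 𝔄 ∧
    ∃ (n : ℕ) (e : Fin n ≃ 𝔄) (k : Fin n),
      IsOpremum (e k) ∧ χ = (diagram e).boxImp (Formula.var k)

/-- The class `V` is axiomatized by Jankov formulas of finite subdirectly irreducible algebras. -/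
def AxiomatizedByJankovFormulas (V : Set Alg.{u}) : Prop :=
  ∃ Γ : Set Formula, (∀ χ ∈ Γ, ∃ 𝔄 : Alg.{u}, IsJankovFormulaOf 𝔄 χ) ∧ V = Mod Γ

/-- The class `V` is defined by characteristic formulas, over `M`, of infinite algebras. -/
def DefinedByCharacteristicFormulas (M V : Set Alg.{u}) : Prop :=
  ∃ Γ : Set Formula,
    (∀ χ ∈ Γ, ∃ 𝔄 : Alg.{u}, Infinite 𝔄 ∧ IsCharacteristicFormula M 𝔄 χ) ∧ V = Mod Γ

end InteriorAlgebra

/-! Non-axiomatizability. A characteristic formula over `M` of an infinite algebra holds in every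
finite member of `M` (`IsCharacteristicFormula.valid_of_finite`). Suppose a nonempty set of such
formulas and a set of Jankov formulas define the same class. An infinite algebra refuting one of the
former refutes the Jankov formula of some finite 𝔅. Then 𝔅 satisfies every formula valid in that
infinite algebra, so it lies in `M` and hence in the class, yet it refutes its own Jankov formula.

Independence. A Rieger–Nishimura ladder receives a twin `d` of the rung `w (n + 3)` and a root `r`;
`M` is generated by the complex algebras of all these frames. With p₀ true at `w 0` and p₁ at `d`,
every rung is described by a formula, so the definable sets form an infinite algebra, whose opremum
is the complement of the root. The position of the twin encodes `n`: in the `m`-th frame only the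
description of rung `m + 3` holds at two worlds. Hence the formula `ladder n`, necessary at a world
satisfying `root`, forces `m = n` and the canonical valuation (`eq_of_sat_root`), and the `m`-th
algebra refutes the `n`-th characteristic formula only if `m = n`. Different index sets thus give
different varieties.

Finite presentability. That `ladder n` defines the algebra over `M` is `sat_of_box_ladder`: a world
where it is necessary satisfies `root` (rigidity), or has p₁ and looks like `d`, or has no p₁ above
it and looks like a rung or a limit of rungs. Countability of the formulas gives the upper bound. -/

namespace InteriorAlgebra

/-! ### Congruences given by open elements, oprema, and generation -/

section Basic

variable {α : Type u} [InteriorAlgebra α]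

theorem box_mono {a b : α} (h : a ≤ b) : box a ≤ box b := by
  rw [← inf_eq_left] at h ⊢
  rw [← box_inf, h]

theorem box_box (a : α) : box (box a) = box a :=
  le_antisymm (box_le _) (box_le_box_box a)

theorem le_box_of_open {a c : α} (hc : box c = c) (h : c ≤ a) : c ≤ box a :=
  hc ▸ box_mono h

theorem eval_boxImp_eq_top {ν : ℕ → α} {φ ψ : Formula} :
    (φ.boxImp ψ).eval ν = ⊤ ↔ box (φ.eval ν) ≤ box (ψ.eval ν) := by
  simp only [Formula.boxImp, Formula.eval, himp_eq_top_iff]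

theorem le_eval_iff {ν : ℕ → α} {φ ψ : Formula} {c : α} :
    c ≤ (φ.iff ψ).eval ν ↔ c ⊓ φ.eval ν = c ⊓ ψ.eval ν := by
  simp only [Formula.iff, Formula.eval, le_inf_iff, le_himp_iff]
  constructor
  · rintro ⟨h₁, h₂⟩
    exact le_antisymm (le_inf inf_le_left h₁) (le_inf inf_le_left h₂)
  · intro h
    exact ⟨h ▸ inf_le_right, h ▸ inf_le_right⟩

theorem le_eval_conj {ν : ℕ → α} {c : α} :
    ∀ {l : List Formula}, c ≤ (Formula.conj l).eval ν ↔ ∀ φ ∈ l, c ≤ φ.eval ν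
  | [] => by simp [Formula.conj, Formula.eval]
  | [φ] => by simp [Formula.conj]
  | φ :: ψ :: l => by
    simp only [Formula.conj, Formula.eval, le_inf_iff, le_eval_conj (l := ψ :: l),
      List.forall_mem_cons]

/-- With the lemmas that follow, this makes `c ⊓ x = c ⊓ y` a congruence in `x`, `y`: computing
modulo the filter above `c`. Openness of `c` matters only for the box. -/
theorem inf_compl_congr {a b c : α} (h : c ⊓ a = c ⊓ b) : c ⊓ aᶜ = c ⊓ bᶜ := by
  have key : ∀ x : α, c ⊓ xᶜ = c ⊓ (c ⊓ x)ᶜ := fun x => by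
    simp [compl_inf, inf_sup_left]
  rw [key a, key b, h]

theorem inf_himp_congr {a b a' b' c : α} (h : c ⊓ a = c ⊓ b) (h' : c ⊓ a' = c ⊓ b') :
    c ⊓ (a ⇨ a') = c ⊓ (b ⇨ b') := by
  rw [himp_eq, himp_eq, inf_sup_left, inf_sup_left, h', inf_compl_congr h]

theorem inf_box_congr {a b c : α} (hc : box c = c) (h : c ⊓ a = c ⊓ b) :
    c ⊓ box a = c ⊓ box b := by
  conv_lhs => rw [← hc, ← box_inf, h, box_inf, hc]

theorem inf_inf_congr {a b a' b' c : α} (h : c ⊓ a = c ⊓ b) (h' : c ⊓ a' = c ⊓ b') :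
    c ⊓ (a ⊓ a') = c ⊓ (b ⊓ b') := by
  rw [inf_inf_distrib_left, h, h', ← inf_inf_distrib_left]

/-- An algebra with an opremum is subdirectly irreducible. -/
theorem IsOpremum.isSubdirectlyIrreducible {b : α} (hb : IsOpremum b) :
    IsSubdirectlyIrreducible α := by
  obtain ⟨⟨hbo, hbt⟩, hmax⟩ := hb
  -- The monolith is the congruence of the filter above `b`.
  refine ⟨⟨fun x y => b ⊓ x = b ⊓ y, fun _ => rfl, fun h => h.symm, fun h h' => h.trans h'⟩,
    ⟨?_, ?_, ?_, ?_, ?_⟩, ?_, ?_⟩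
  · exact fun x y z t h h' => inf_inf_congr h h'
  · intro x y z t h h'
    change b ⊓ (x ⊔ z) = b ⊓ (y ⊔ t)
    rw [inf_sup_left, inf_sup_left, show b ⊓ x = b ⊓ y from h, show b ⊓ z = b ⊓ t from h']
  · exact fun x y z t h h' => inf_himp_congr h h'
  · exact fun x y h => inf_compl_congr h
  · exact fun x y h => inf_box_congr hbo h
  · intro h
    have : (⊥ : Setoid α) b ⊤ := by
      rw [← h]
      change b ⊓ b = b ⊓ ⊤
      simp
    exact hbt this
  · intro θ hθ hne
    obtain ⟨x, y, hxy, hne⟩ : ∃ x y, θ x y ∧ x ≠ y := by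
      by_contra! hcon
      exact hne (le_bot_iff.1 fun x y h => hcon x y h)
    -- If `x ≠ y` are related, then □(x ↔ y) is related to `⊤`; it is open and not `⊤`, hence below
    -- `b`, so `b` is related to `⊤` too.
    have htop : θ ((x ⇨ y) ⊓ (y ⇨ x)) ⊤ := by
      have h := hθ.inf _ _ _ _ (hθ.himp _ _ _ _ hxy (θ.refl y)) (hθ.himp _ _ _ _ (θ.refl y) hxy)
      simpa using h
    have hbox := hθ.box _ _ htop
    rw [box_top] at hbox
    have hle : box ((x ⇨ y) ⊓ (y ⇨ x)) ≤ b := by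
      refine hmax ⟨box_box _, fun h => hne ?_⟩
      have h' := top_le_iff.1 (h ▸ box_le _)
      rw [inf_eq_top_iff, himp_eq_top_iff, himp_eq_top_iff] at h'
      exact le_antisymm h'.1 h'.2
    have hbθ : θ b ⊤ := by
      have h := hθ.sup _ _ _ _ hbox (θ.refl b)
      rwa [sup_eq_right.2 hle, top_sup_eq] at h
    intro z t hzt
    have key : ∀ z, θ (b ⊓ z) z := fun z => by
      simpa using hθ.inf _ _ _ _ hbθ (θ.refl z)
    have hzt : b ⊓ z = b ⊓ t := hzt
    exact θ.trans (θ.symm (key z)) (hzt ▸ key t)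

/-- In an algebra generated by the values of the variables of `P`, every element is the value of a
formula in these variables. -/
theorem Generates.exists_eval {P : Finset ℕ} {ν : ℕ → α}
    (h : Generates (ν '' (P : Set ℕ))) (a : α) : ∃ φ : Formula, φ.vars ⊆ P ∧ φ.eval ν = a := by
  have hS : {a : α | ∃ φ : Formula, φ.vars ⊆ P ∧ φ.eval ν = a} = Set.univ := by
    apply h
    · constructor
      · rintro _ ⟨φ, hφ, rfl⟩ _ ⟨ψ, hψ, rfl⟩
        exact ⟨.and φ ψ, Finset.union_subset hφ hψ, rfl⟩
      · rintro _ ⟨φ, hφ, rfl⟩ _ ⟨ψ, hψ, rfl⟩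
        exact ⟨.or φ ψ, Finset.union_subset hφ hψ, rfl⟩
      · rintro _ ⟨φ, hφ, rfl⟩ _ ⟨ψ, hψ, rfl⟩
        exact ⟨.imp φ ψ, Finset.union_subset hφ hψ, rfl⟩
      · rintro _ ⟨φ, hφ, rfl⟩
        exact ⟨.neg φ, hφ, rfl⟩
      · rintro _ ⟨φ, hφ, rfl⟩
        exact ⟨.box φ, hφ, rfl⟩
    · rintro _ ⟨i, hi, rfl⟩
      exact ⟨.var i, by simpa [Formula.vars] using hi, rfl⟩
  exact hS.ge (Set.mem_univ a)

end Basic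

/-! ### Characteristic formulas of infinite algebras are not Jankov formulas -/

theorem IsCharacteristicFormula.not_valid {M : Set Alg.{u}} {𝔄 : Alg.{u}} {χ : Formula}
    (h : IsCharacteristicFormula M 𝔄 χ) : ¬ Valid 𝔄 χ := by
  obtain ⟨-, -, P, φ, ψ, ν, hd, -, ho, rfl⟩ := h
  intro hv
  have h := eval_boxImp_eq_top.1 (hv ν)
  rw [hd.eval_eq_top, box_top, ho.1.1, top_le_iff] at h
  exact ho.1.2 h

/-- A characteristic formula over `M` of an infinite algebra is valid in all finite members
of `M`. -/
theorem IsCharacteristicFormula.valid_of_finite {M : Set Alg.{u}} {𝔄 : Alg.{u}} {χ : Formula}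
    (h : IsCharacteristicFormula M 𝔄 χ) [Infinite 𝔄] {𝔅 : Alg.{u}} (hB : 𝔅 ∈ M) [Finite 𝔅] :
    Valid 𝔅 χ := by
  obtain ⟨-, -, P, φ, ψ, ν, hd, hψ, ho, rfl⟩ := h
  intro w
  rw [eval_boxImp_eq_top]
  set c := box (φ.eval w) with hc
  have hco : box c = c := box_box _
  have hder : ∀ θ : Formula, θ.vars ⊆ P → θ.eval ν = ⊤ → c ≤ θ.eval w := fun θ hθ hθν =>
    (eval_boxImp_eq_top.1 (hd.derives θ hθ hθν 𝔅 hB w)).trans (box_le _)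
  choose F hF hFν using fun a => hd.generates.exists_eval a
  -- Pigeonhole: two distinct elements of `𝔄` have naming formulas that agree modulo `c` in the
  -- finite `𝔅`.
  obtain ⟨a, b, hab, hne⟩ := not_injective_infinite_finite
    (fun a : 𝔄 => c ⊓ (F a).eval w) |> fun h => by
      simpa [Function.Injective] using h
  apply le_box_of_open hco
  -- In `𝔄` the element □(a ↔ b) is open and not `⊤`, so it lies below the opremum. The implication
  -- therefore has value `⊤` there, and the defining formula passes it on to `𝔅`.
  have hθ := hder (.imp (.box (.iff (F a) (F b))) ψ)
    (by simp [Formula.vars, Formula.iff, hF, hψ, Finset.union_subset_iff]) (by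
      rw [Formula.eval, himp_eq_top_iff]
      refine ho.2 ⟨box_box _, fun h => hne ?_⟩
      have h' : ⊤ ≤ (Formula.iff (F a) (F b)).eval ν := h ▸ box_le _
      rw [le_eval_iff, top_inf_eq, top_inf_eq, hFν, hFν] at h'
      exact h')
  rw [Formula.eval, le_himp_iff] at hθ
  exact (le_inf le_rfl (le_box_of_open hco (le_eval_iff.2 hab))).trans hθ

theorem IsJankovFormulaOf.not_valid {𝔅 : Alg.{u}} {χ : Formula} (h : IsJankovFormulaOf 𝔅 χ) :
    ¬ Valid 𝔅 χ := by
  obtain ⟨-, n, e, k, ho, rfl⟩ := h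
  intro hv
  let ν : ℕ → 𝔅 := fun i => if h : i < n then e ⟨i, h⟩ else ⊤
  have hν : ∀ b, ν (e.symm b) = b := fun b => by simp [ν]
  have h := eval_boxImp_eq_top.1 (hv ν)
  have hD : (⊤ : 𝔅) ≤ (diagram e).eval ν := by
    refine le_eval_conj.2 fun θ hθ => ?_
    simp only [List.mem_append, List.mem_map] at hθ
    rcases hθ with (((⟨x, -, rfl⟩ | ⟨x, -, rfl⟩) | ⟨x, -, rfl⟩) | ⟨x, -, rfl⟩) | ⟨x, -, rfl⟩ <;>
    simp [le_eval_iff, Formula.eval, hν]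
  rw [top_le_iff.1 hD, box_top, top_le_iff] at h
  have hk : (Formula.var k).eval ν = e k := by simp [Formula.eval, ν]
  rw [hk, ho.1.1] at h
  exact ho.1.2 h

/-- If a Jankov formula of `𝔅` is refuted in `𝔄`, then every formula valid in `𝔄` is valid
in `𝔅`. -/
theorem IsJankovFormulaOf.valid_of_not_valid {𝔄 𝔅 : Alg.{u}} {χ θ : Formula}
    (h : IsJankovFormulaOf 𝔅 χ) (hA : ¬ Valid 𝔄 χ) (hθ : Valid 𝔄 θ) : Valid 𝔅 θ := by
  obtain ⟨-, n, e, k, ho, rfl⟩ := h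
  obtain ⟨w, hw⟩ := not_forall.1 hA
  rw [eval_boxImp_eq_top] at hw
  set c := box ((diagram e).eval w) with hc
  have hco : box c = c := box_box _
  -- The diagram makes `f` a homomorphism modulo `c`. A refutation of `θ` in `𝔅` would put its box
  -- below the opremum, forcing `c ≤ f (e k)` against `hw`.
  let f : 𝔅 → 𝔄 := fun b => w (e.symm b)
  have hD := le_eval_conj.1 (box_le ((diagram e).eval w))
  rw [← hc] at hD
  simp only [List.mem_append] at hD
  have hmem : ∀ b, b ∈ (List.finRange n).map e := fun b =>
    List.mem_map.2 ⟨e.symm b, List.mem_finRange _, by simp⟩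
  have hinf : ∀ a b, c ⊓ (f a ⊓ f b) = c ⊓ f (a ⊓ b) := fun a b => le_eval_iff.1 <| hD _ <|
    .inl <| .inl <| .inl <| .inl <|
    List.mem_map.2 ⟨(a, b), List.pair_mem_product.2 ⟨hmem a, hmem b⟩, rfl⟩
  have hsup : ∀ a b, c ⊓ (f a ⊔ f b) = c ⊓ f (a ⊔ b) := fun a b => le_eval_iff.1 <| hD _ <|
    .inl <| .inl <| .inl <| .inr <|
    List.mem_map.2 ⟨(a, b), List.pair_mem_product.2 ⟨hmem a, hmem b⟩, rfl⟩
  have himp : ∀ a b, c ⊓ (f a ⇨ f b) = c ⊓ f (a ⇨ b) := fun a b => le_eval_iff.1 <| hD _ <|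
    .inl <| .inl <| .inr <|
    List.mem_map.2 ⟨(a, b), List.pair_mem_product.2 ⟨hmem a, hmem b⟩, rfl⟩
  have hneg : ∀ a, c ⊓ (f a)ᶜ = c ⊓ f aᶜ := fun a => le_eval_iff.1 <| hD _ <|
    .inl <| .inr <| List.mem_map.2 ⟨a, hmem a, rfl⟩
  have hbox : ∀ a, c ⊓ box (f a) = c ⊓ f (box a) := fun a => le_eval_iff.1 <| hD _ <|
    .inr <| List.mem_map.2 ⟨a, hmem a, rfl⟩
  intro ν
  by_contra hne
  have hev : ∀ φ : Formula, c ⊓ φ.eval (fun i => f (ν i)) = c ⊓ f (φ.eval ν) := by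
    intro φ
    induction φ with
    | var i => rfl
    | and φ ψ h₁ h₂ => exact (inf_inf_congr h₁ h₂).trans (hinf _ _)
    | or φ ψ h₁ h₂ =>
      refine Eq.trans ?_ (hsup _ _)
      rw [Formula.eval, inf_sup_left, inf_sup_left, h₁, h₂]
    | imp φ ψ h₁ h₂ => exact (inf_himp_congr h₁ h₂).trans (himp _ _)
    | neg φ h₁ => exact (inf_compl_congr h₁).trans (hneg _)
    | box φ h₁ => exact (inf_box_congr hco h₁).trans (hbox _)
  have h₁ : c ≤ f (θ.eval ν) := by
    have := hev θ
    rw [hθ, inf_top_eq] at this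
    exact this ▸ inf_le_right
  have h₂ : c ≤ f (box (θ.eval ν)) := by
    have := hbox (θ.eval ν)
    rw [inf_eq_left.2 (le_box_of_open hco h₁)] at this
    exact this ▸ inf_le_right
  have h₃ : box (θ.eval ν) ≤ e k :=
    ho.2 ⟨box_box _, fun h => hne (top_le_iff.1 (h ▸ box_le _))⟩
  have h₄ : c ≤ f (e k) := by
    have := hinf (box (θ.eval ν)) (e k)
    rw [inf_eq_left.2 h₃, inf_eq_left.2 h₂] at this
    exact (this ▸ inf_le_right : c ≤ f (box (θ.eval ν)) ⊓ f (e k)).trans inf_le_right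
  apply hw
  apply le_box_of_open hco
  simpa [f, Formula.eval] using h₄

/-- A nonempty set of characteristic formulas, over a variety, of infinite algebras does not define
the same variety as any set of Jankov formulas. -/
theorem not_axiomatizedByJankovFormulas {M : Set Alg.{u}} (hM : IsVariety M) {Γ : Set Formula}
    (hΓ : ∀ χ ∈ Γ, ∃ 𝔄 : Alg.{u}, Infinite 𝔄 ∧ IsCharacteristicFormula M 𝔄 χ)
    (hne : Γ.Nonempty) : ¬ AxiomatizedByJankovFormulas (Mod.{u} Γ) := by
  rintro ⟨Δ, hΔ, hmod⟩
  obtain ⟨Θ, rfl⟩ := hM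
  obtain ⟨χ, hχ⟩ := hne
  obtain ⟨𝔄, -, hA⟩ := hΓ χ hχ
  have hA' : 𝔄 ∉ Mod Δ := hmod ▸ fun h => hA.not_valid (h χ hχ)
  obtain ⟨δ, hδ, hAδ⟩ : ∃ δ ∈ Δ, ¬ Valid 𝔄 δ := by simpa [Mod] using hA'
  obtain ⟨𝔅, hB⟩ := hΔ δ hδ
  have hBM : 𝔅 ∈ Mod Θ := fun θ hθ => hB.valid_of_not_valid hAδ (hA.1 θ hθ)
  have : Finite 𝔅 := by
    obtain ⟨-, n, e, -⟩ := hB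
    exact Finite.of_equiv _ e
  have hBΓ : 𝔅 ∈ Mod Γ := fun γ hγ => by
    obtain ⟨ℭ, _, hC⟩ := hΓ γ hγ
    exact hC.valid_of_finite hBM
  rw [hmod] at hBΓ
  exact hB.not_valid (hBΓ δ hδ)

end InteriorAlgebra

namespace InteriorAlgebra

/-! ### Kripke semantics -/

namespace Formula

/-- `◇φ`. -/
def dia (φ : Formula) : Formula := neg (box (neg φ))

/-- Truth of a formula at a world of the Kripke model with accessibility relation `R` and
valuation `V`. -/
def Sat {W : Type u} (R : W → W → Prop) (V : ℕ → Set W) : Formula → W → Prop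
  | var i, x => x ∈ V i
  | and φ ψ, x => φ.Sat R V x ∧ ψ.Sat R V x
  | or φ ψ, x => φ.Sat R V x ∨ ψ.Sat R V x
  | imp φ ψ, x => φ.Sat R V x → ψ.Sat R V x
  | neg φ, x => ¬ φ.Sat R V x
  | box φ, x => ∀ y, R x y → φ.Sat R V y

theorem sat_dia {W : Type u} {R : W → W → Prop} {V : ℕ → Set W} {φ : Formula} {x : W} :
    φ.dia.Sat R V x ↔ ∃ y, R x y ∧ φ.Sat R V y := by
  simp [dia, Sat]

end Formula

/-- The interior algebra of all subsets of a Kripke frame. -/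
def complexAlgebra {W : Type u} (R : W → W → Prop) (hrefl : ∀ x, R x x)
    (htrans : ∀ x y z, R x y → R y z → R x z) : Alg.{u} where
  carrier := Set W
  str :=
    { (inferInstance : BooleanAlgebra (Set W)) with
      box := fun S => {x | ∀ y, R x y → y ∈ S}
      box_top := Set.eq_univ_of_forall fun _ _ _ => trivial
      box_inf := fun _ _ => Set.ext fun _ =>
        ⟨fun h => ⟨fun y hy => (h y hy).1, fun y hy => (h y hy).2⟩,
          fun h y hy => ⟨h.1 y hy, h.2 y hy⟩⟩
      box_le := fun _ x h => h x (hrefl x)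
      box_le_box_box := fun _ x h y hy z hz => h z (htrans x y z hy hz) }

theorem eval_complexAlgebra {W : Type u} {R : W → W → Prop} (hrefl : ∀ x, R x x)
    (htrans : ∀ x y z, R x y → R y z → R x z) (V : ℕ → Set W) (φ : Formula) :
    (φ.eval (α := complexAlgebra R hrefl htrans) V : Set W) = {x | φ.Sat R V x} := by
  induction φ with
  | var i => rfl
  | and φ ψ h₁ h₂ => exact congrArg₂ (fun S T : Set W => S ⊓ T) h₁ h₂
  | or φ ψ h₁ h₂ => exact congrArg₂ (fun S T : Set W => S ⊔ T) h₁ h₂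
  | imp φ ψ h₁ h₂ =>
    refine (congrArg₂ (fun S T : Set W => S ⇨ T) h₁ h₂).trans ?_
    ext x
    simp [Formula.Sat, himp_eq, imp_iff_or_not]
  | neg φ h₁ => exact congrArg (fun S : Set W => Sᶜ) h₁
  | box φ h₁ => exact congrArg (fun S : Set W => {x | ∀ y, R x y → y ∈ S}) h₁

theorem valid_complexAlgebra {W : Type u} {R : W → W → Prop} {hrefl : ∀ x, R x x}
    {htrans : ∀ x y z, R x y → R y z → R x z} {φ : Formula} :
    Valid (complexAlgebra R hrefl htrans) φ ↔ ∀ (V : ℕ → Set W) x, φ.Sat R V x := by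
  refine forall_congr' fun V => ?_
  exact (Eq.congr_left (eval_complexAlgebra hrefl htrans V φ)).trans Set.eq_univ_iff_forall

/-! ### Ladders with a twin and a root -/

/-- The rungs `w 0, w 1, …` of a Rieger–Nishimura ladder, a further world `d` and a root `r`. -/
inductive World : Type u
  | w : ℕ → World
  | d : World
  | r : World

namespace World

/-- Accessibility: `w j` sees itself and all `w k` with `k + 2 ≤ j`, the root sees everything, and
`d` sees itself and the same rungs as `w (n + 3)` does, apart from `w (n + 3)`. -/
def Sees (n : ℕ) : World.{u} → World.{u} → Prop
  | r, _ => True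
  | w j, w k => k = j ∨ k + 2 ≤ j
  | w _, d => False
  | w _, r => False
  | d, w k => k ≤ n + 1
  | d, d => True
  | d, r => False

theorem sees_refl (n : ℕ) (x : World.{u}) : Sees n x x := by
  cases x <;> simp [Sees]

theorem sees_trans (n : ℕ) (x y z : World.{u}) (h : Sees n x y) (h' : Sees n y z) :
    Sees n x z := by
  cases x <;> cases y <;> cases z <;> simp only [Sees] at h h' ⊢ <;> omega

theorem eq_r_of_sees_r {n : ℕ} {x : World.{u}} (h : Sees n x r) : x = r := by
  cases x <;> simp_all [Sees]

theorem eq_of_sees_w {m k : ℕ} (hk : k ≤ 1) {z : World.{u}} (h : Sees m (w k) z) :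
    z = w k := by
  cases z with
  | w j =>
    simp only [Sees] at h
    rw [show j = k by omega]
  | d => exact h.elim
  | r => exact h.elim

/-- The valuation `p₀ ↦ {w 0}`, `p₁ ↦ {d}`. -/
def val (i : ℕ) : Set World.{u} := if i = 1 then {d} else {w 0}

theorem mem_val_zero {x : World.{u}} : x ∈ val 0 ↔ x = w 0 := by simp [val]

theorem mem_val_one {x : World.{u}} : x ∈ val 1 ↔ x = d := by simp [val]

end World

open World

namespace Formula

/-- A formula in `p₀` that describes the rung `w k` of the ladder. -/
def rung : ℕ → Formula
  | 0 => var 0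
  | 1 => box (neg (var 0))
  | k + 2 => and (dia (rung k)) (and (neg (dia (rung (k + 1)))) (neg (rung k)))

/-- A formula that describes the root of the ladder. -/
def root : Formula := and (neg (var 1)) (dia (var 1))

/-- The formula that defines the algebra of the `n`-th ladder. -/
def ladder (n : ℕ) : Formula :=
  and (imp (var 0) (box (var 0)))
    (and (imp (var 1) (and (neg (var 0))
      (and (box (imp (neg (var 1)) (box (neg (var 1)))))
      (and (dia (and (rung (n + 1)) (neg (var 1))))
      (and (dia (and (rung n) (neg (var 1))))
      (and (neg (dia (and (rung (n + 2)) (neg (var 1)))))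
        (neg (dia (and (rung (n + 3)) (neg (var 1)))))))))))
    (imp root (and (dia (rung 0)) (and (dia (rung 1)) (and (dia (rung 2))
      (and (dia (and (rung (n + 3)) (var 1))) (dia (and (rung (n + 3)) (neg (var 1))))))))))

theorem vars_rung : ∀ k, (rung k).vars ⊆ {0, 1}
  | 0 => by simp [rung, vars]
  | 1 => by simp [rung, vars]
  | k + 2 => by
    simp [rung, vars, dia, Finset.union_subset_iff, vars_rung k, vars_rung (k + 1)]

theorem vars_root : root.vars ⊆ {0, 1} := by simp [root, vars, dia]

theorem vars_ladder (n : ℕ) : (ladder n).vars ⊆ {0, 1} := by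
  simp only [ladder, vars, dia, Finset.union_subset_iff, vars_rung, vars_root]
  simp

/-- The content of `ladder n` at a world of a model. -/
theorem sat_ladder {W : Type u} {R : W → W → Prop} {V : ℕ → Set W} {n : ℕ} {x : W} :
    (ladder n).Sat R V x ↔
      (x ∈ V 0 → ∀ y, R x y → y ∈ V 0) ∧
      (x ∈ V 1 → x ∉ V 0 ∧ (∀ y, R x y → y ∉ V 1 → ∀ z, R y z → z ∉ V 1) ∧
        (∃ y, R x y ∧ (rung (n + 1)).Sat R V y ∧ y ∉ V 1) ∧
        (∃ y, R x y ∧ (rung n).Sat R V y ∧ y ∉ V 1) ∧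
        (¬ ∃ y, R x y ∧ (rung (n + 2)).Sat R V y ∧ y ∉ V 1) ∧
        (¬ ∃ y, R x y ∧ (rung (n + 3)).Sat R V y ∧ y ∉ V 1)) ∧
      (x ∉ V 1 ∧ (∃ y, R x y ∧ y ∈ V 1) →
        (∃ y, R x y ∧ (rung 0).Sat R V y) ∧ (∃ y, R x y ∧ (rung 1).Sat R V y) ∧
        (∃ y, R x y ∧ (rung 2).Sat R V y) ∧
        (∃ y, R x y ∧ (rung (n + 3)).Sat R V y ∧ y ∈ V 1) ∧
        (∃ y, R x y ∧ (rung (n + 3)).Sat R V y ∧ y ∉ V 1)) := by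
  simp only [ladder, root, Sat, sat_dia]

theorem sat_root {W : Type u} {R : W → W → Prop} {V : ℕ → Set W} {x : W} :
    root.Sat R V x ↔ x ∉ V 1 ∧ ∃ y, R x y ∧ y ∈ V 1 := by
  simp only [root, Sat, sat_dia]

/-- If `w 0` is the only world above `x` with `p₀`, then the formula `rung k` is true, above `x`, at
`w k` and at its twin only. -/
theorem sat_rung {m : ℕ} {V : ℕ → Set World.{u}} {x : World.{u}}
    (hp : ∀ y, Sees m x y → (y ∈ V 0 ↔ y = w 0)) :
    ∀ k y, Sees m x y → ((rung k).Sat (Sees m) V y ↔ y = w k ∨ (k = m + 3 ∧ y = d))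
  | 0, y, hy => by simp [rung, Sat, hp y hy]
  | 1, y, hy => by
    have h : (rung 1).Sat (Sees m) V y ↔ ¬ Sees m y (w 0) := by
      simp only [rung, Sat]
      constructor
      · exact fun h h0 => h _ h0 ((hp _ (sees_trans m _ _ _ hy h0)).2 rfl)
      · intro h z hz hz0
        exact h ((hp _ (sees_trans m _ _ _ hy hz)).1 hz0 ▸ hz)
    rw [h]
    cases y <;> simp [Sees]
    omega
  | k + 2, y, hy => by
    have h : ∀ j, (∀ z, Sees m x z →
        ((rung j).Sat (Sees m) V z ↔ z = w j ∨ (j = m + 3 ∧ z = d))) →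
        ((rung j).dia.Sat (Sees m) V y ↔ Sees m y (w j) ∨ (j = m + 3 ∧ Sees m y d)) := by
      intro j hj
      rw [sat_dia]
      constructor
      · rintro ⟨z, hz, hzs⟩
        rcases (hj z (sees_trans m _ _ _ hy hz)).1 hzs with rfl | ⟨rfl, rfl⟩
        · exact .inl hz
        · exact .inr ⟨rfl, hz⟩
      · rintro (hz | ⟨rfl, hz⟩)
        · exact ⟨_, hz, (hj _ (sees_trans m _ _ _ hy hz)).2 (.inl rfl)⟩
        · exact ⟨_, hz, (hj _ (sees_trans m _ _ _ hy hz)).2 (.inr ⟨rfl, rfl⟩)⟩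
    have h₁ := h k (sat_rung hp k)
    have h₂ := h (k + 1) (sat_rung hp (k + 1))
    simp only [rung, Sat, h₁, h₂, sat_rung hp k y hy]
    -- Among rungs only `w k` and `w (k + 2)` see `w k` but not `w (k + 1)`; `d` does so exactly for
    -- `k = m + 1`, and `r` sees everything.
    cases y <;> simp [Sees] <;> omega

theorem sat_rung_val {n k : ℕ} {x : World.{u}} :
    (rung k).Sat (Sees n) val x ↔ x = w k ∨ (k = n + 3 ∧ x = d) :=
  sat_rung (x := r) (fun _ _ => mem_val_zero) k x trivial

theorem sat_root_val {n : ℕ} {x : World.{u}} : root.Sat (Sees n) val x ↔ x = r := by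
  rw [sat_root]
  cases x <;> simp [mem_val_one, Sees]

theorem sat_ladder_val (n : ℕ) (x : World.{u}) : (ladder n).Sat (Sees n) val x := by
  rw [sat_ladder]
  simp only [sat_rung_val, mem_val_zero, mem_val_one]
  refine ⟨?_, ?_, ?_⟩
  · rintro rfl y hy
    cases y <;> simp_all [Sees]
  · rintro rfl
    refine ⟨by simp, ?_, ⟨w (n + 1), by simp [Sees]⟩, ⟨w n, by simp [Sees]⟩, ?_, ?_⟩
    · intro y hy hyd z hz hzd
      subst hzd
      cases y <;> simp_all [Sees]
    · rintro ⟨y, hy, hy', hyd⟩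
      cases y <;> simp_all [Sees]
    · rintro ⟨y, hy, hy', hyd⟩
      cases y <;> simp_all [Sees]
  · rintro ⟨hxd, y, hy, rfl⟩
    obtain rfl : x = r := by cases x <;> simp_all [Sees]
    exact ⟨⟨w 0, by simp [Sees]⟩, ⟨w 1, by simp [Sees]⟩, ⟨w 2, by simp [Sees]⟩,
      ⟨d, by simp [Sees]⟩, ⟨w (n + 3), by simp [Sees]⟩⟩

/-- Above a world that sees worlds satisfying `rung 0`, `rung 1` and `rung 2`, the variable `p₀`
is true at `w 0` only. -/
theorem mem_iff_of_sees_rungs {m : ℕ} {V : ℕ → Set World.{u}} {x : World.{u}}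
    (hup : ∀ y z, Sees m x y → Sees m y z → y ∈ V 0 → z ∈ V 0)
    (h₀ : (rung 0).dia.Sat (Sees m) V x) (h₁ : (rung 1).dia.Sat (Sees m) V x)
    (h₂ : (rung 2).dia.Sat (Sees m) V x) (y : World.{u}) (hy : Sees m x y) :
    y ∈ V 0 ↔ y = w 0 := by
  simp only [rung, Sat, sat_dia] at h₀ h₁ h₂
  obtain ⟨y₀, hy₀, h₀⟩ := h₀
  obtain ⟨y₁, hy₁, h₁⟩ := h₁
  obtain ⟨y₂, hy₂, -, h₂', h₂''⟩ := h₂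
  have hmax : ∀ y : World.{u}, Sees m y (w 0) ∨ y = w 1 := by
    intro y
    cases y <;> simp [Sees]
    omega
  have hmax' : ∀ y : World.{u}, Sees m y (w 1) ∨ y = w 0 ∨ y = w 2 := by
    intro y
    cases y <;> simp [Sees]
    omega
  -- Rung 2 excludes the valuation with the roles of `w 0` and `w 1` exchanged: without p₀ at `w 0`,
  -- both `y₀` and `y₂` would be `w 1`, which cannot both have and lack p₀.
  have hw₀ : w 0 ∈ V 0 := by
    by_contra hcon
    have hy₀' : y₀ = w 1 := (hmax y₀).resolve_left fun h => hcon (hup _ _ hy₀ h h₀)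
    have hy₂' : y₂ = w 1 := (hmax y₂).resolve_left fun h => h₂' ⟨w 0, h, fun z hz =>
      eq_of_sees_w (Nat.zero_le 1) hz ▸ hcon⟩
    exact h₂'' (hy₂' ▸ hy₀' ▸ h₀)
  have hy₁' : y₁ = w 1 := (hmax y₁).resolve_left fun h => h₁ _ h hw₀
  have hw₁ : w 1 ∉ V 0 := hy₁' ▸ h₁ _ (sees_refl m _)
  have hnot : ¬ Sees m y₂ (w 1) := fun h => h₂' ⟨_, h, fun z hz =>
    eq_of_sees_w le_rfl hz ▸ hw₁⟩
  have hy₂' : y₂ = w 2 := by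
    rcases (hmax' y₂).resolve_left hnot with rfl | h
    · exact absurd hw₀ h₂''
    · exact h
  subst hy₂'
  constructor
  · intro hyV
    rcases hmax' y with h | h | rfl
    · exact absurd (hup _ _ hy h hyV) hw₁
    · exact h
    · exact absurd hyV h₂''
  · rintro rfl
    exact hw₀

/-- Rigidity: above a world where `ladder n` is necessary and `root` is true, the model is the
`n`-th ladder. -/
theorem eq_of_sat_root {m n : ℕ} {V : ℕ → Set World.{u}} {x : World.{u}}
    (hx : ∀ y, Sees m x y → (ladder n).Sat (Sees m) V y) (hq : root.Sat (Sees m) V x) :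
    m = n ∧ V 0 = val 0 ∧ V 1 = val 1 := by
  simp only [sat_ladder] at hx
  rw [sat_root] at hq
  obtain ⟨h₀, h₁, h₂, ⟨a, ha, haT, hav⟩, ⟨b, hb, hbT, hbv⟩⟩ :=
    (hx x (sees_refl m x)).2.2 hq
  have hup : ∀ y z, Sees m x y → Sees m y z → y ∈ V 0 → z ∈ V 0 :=
    fun y z hy hz h => (hx y hy).1 h z hz
  have hp := mem_iff_of_sees_rungs hup (sat_dia.2 h₀) (sat_dia.2 h₁) (sat_dia.2 h₂)
  have hT := sat_rung hp
  rw [hT _ _ ha] at haT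
  rw [hT _ _ hb] at hbT
  have hab : a ≠ b := fun h => hbv (h ▸ hav)
  have hmn : m = n := by
    rcases haT with rfl | ⟨h, rfl⟩
    · rcases hbT with rfl | ⟨h, rfl⟩
      · exact absurd rfl hab
      · omega
    · omega
  subst hmn
  have hxr : x = r := by
    have hd : Sees m x d ∧ Sees m x (w (m + 3)) := by
      rcases haT with rfl | ⟨-, rfl⟩ <;> rcases hbT with rfl | ⟨-, rfl⟩
      · exact absurd rfl hab
      · exact ⟨hb, ha⟩
      · exact ⟨ha, hb⟩
      · exact absurd rfl hab
    cases x with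
    | w k => exact hd.1.elim
    | d =>
      have : m + 3 ≤ m + 1 := hd.2
      omega
    | r => rfl
  subst hxr
  have hr : ∀ y : World.{u}, Sees m r y := fun _ => trivial
  simp only [hr, true_imp_iff] at hx hT hp
  simp only [hT] at hx
  -- A rung with p₁ sees both `w (m + 1)` and `w m`; seeing `w (m + 1)` alone would allow `k = m +
  -- 1`.
  have hlow : ∀ k, w k ∈ V 1 → m + 3 ≤ k := by
    intro k hk
    obtain ⟨-, -, ⟨y, hy, hy', -⟩, ⟨z, hz, hz', -⟩, -⟩ := (hx _).2.1 hk
    obtain rfl : y = w (m + 1) := hy'.resolve_right fun h => by omega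
    obtain rfl : z = w m := hz'.resolve_right fun h => by omega
    simp only [Sees] at hy hz
    omega
  -- The twins are told apart by `w (m + 5)`, which sees `w (m + 3)` but not `d`. If p₁ sat on `w (m
  -- + 3)`, then `w (m + 5)` would satisfy `root` without seeing the p₁-free twin, or have p₁ while
  -- seeing `w (m + 2)`.
  have hw : w (m + 3) ∉ V 1 := by
    intro hin
    have hdn : d ∉ V 1 := by
      rcases hbT with rfl | ⟨-, rfl⟩
      · exact absurd hin hbv
      · exact hbv
    by_cases h5 : w (m + 5) ∈ V 1
    · exact ((hx _).2.1 h5).2.2.2.2.1 ⟨w (m + 2), by simp [Sees], .inl rfl, fun h => by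
        have := hlow _ h
        omega⟩
    · obtain ⟨-, -, -, -, z, hz, hzT, hzv⟩ :=
        (hx _).2.2 ⟨h5, w (m + 3), by simp [Sees], hin⟩
      rcases hzT with rfl | ⟨-, rfl⟩
      · exact hzv hin
      · exact hz
  have had : a = d := by
    rcases haT with rfl | ⟨-, rfl⟩
    · exact absurd hav hw
    · rfl
  subst had
  refine ⟨rfl, ?_, ?_⟩
  · ext y
    rw [hp y, mem_val_zero]
  · ext y
    rw [mem_val_one]
    refine ⟨fun h => ?_, fun h => h ▸ hav⟩
    cases y with
    | w k =>
      have hk := hlow k h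
      rcases hk.eq_or_lt with rfl | hk
      · exact absurd h hw
      · exact absurd ⟨w (m + 2), by simp [Sees]; omega, .inl rfl, fun h => by
          have := hlow _ h
          omega⟩ ((hx _).2.1 h).2.2.2.2.1
    | d => rfl
    | r => exact absurd h hq.1

end Formula

end InteriorAlgebra

/-! ### Bisimulation with the canonical model and finite presentability -/

namespace InteriorAlgebra

open World

namespace World

theorem sees_antisymm {n : ℕ} {x y : World.{u}} (h : Sees n x y) (h' : Sees n y x) : x = y := by
  cases x with
  | w j =>
    cases y with
    | w k =>
      simp only [Sees] at h h'
      rw [show j = k by omega]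
    | d => exact h.elim
    | r => exact h.elim
  | d =>
    cases y with
    | w k => exact h'.elim
    | d => rfl
    | r => exact h.elim
  | r => exact (eq_r_of_sees_r h').symm

theorem sees_induction {n : ℕ} {P : World.{u} → Prop}
    (h : ∀ x, (∀ z, Sees n x z → z ≠ x → P z) → P x) (x : World.{u}) : P x := by
  have hw : ∀ k, P (w k) := by
    intro k
    induction k using Nat.strong_induction_on with
    | _ k ih =>
      refine h _ fun z hz hne => ?_
      cases z with
      | w j =>
        refine ih j (lt_of_le_of_ne ?_ fun h => hne (h ▸ rfl))
        simp only [Sees] at hz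
        omega
      | d => exact hz.elim
      | r => exact hz.elim
  have hd : P d := by
    refine h _ fun z hz hne => ?_
    cases z with
    | w j => exact hw j
    | d => exact absurd rfl hne
    | r => exact hz.elim
  cases x with
  | w k => exact hw k
  | d => exact hd
  | r =>
    refine h _ fun z _ hne => ?_
    cases z with
    | w j => exact hw j
    | d => exact hd
    | r => exact absurd rfl hne

theorem finite_sees (n : ℕ) {x : World.{u}} (hx : x ≠ r) : {z | Sees n x z ∧ z ≠ x}.Finite := by
  have hfin : ∀ B : ℕ, (w.{u} '' Set.Iic B).Finite := fun B => (Set.finite_Iic B).image _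
  cases x with
  | w k =>
    refine (hfin k).subset ?_
    rintro z ⟨hz, hne⟩
    cases z with
    | w j =>
      refine ⟨j, ?_, rfl⟩
      simp only [Sees] at hz
      simp only [Set.mem_Iic]
      omega
    | d => exact hz.elim
    | r => exact hz.elim
  | d =>
    refine (hfin (n + 1)).subset ?_
    rintro z ⟨hz, hne⟩
    cases z with
    | w j => exact ⟨j, hz, rfl⟩
    | d => exact absurd rfl hne
    | r => exact hz.elim
  | r => exact absurd rfl hx

end World

namespace Formula

/-- The world `x` of the `m`-th ladder with the valuation `V` satisfies the same formulas in
`p₀, p₁` as the world `y` of the `n`-th ladder with its canonical valuation. -/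
def SameTheory (m n : ℕ) (V : ℕ → Set World.{u}) (x y : World.{u}) : Prop :=
  ∀ ψ : Formula, ψ.vars ⊆ {0, 1} → (ψ.Sat (Sees m) V x ↔ ψ.Sat (Sees n) val y)

variable {m n : ℕ} {V : ℕ → Set World.{u}} {x y z : World.{u}}

/-- The pair `x`, `y` itself is handled by the induction on formulas, so only other successors need
partners; a partner may be `x` or `y`. -/
theorem SameTheory.of_bisim (h0 : x ∈ V 0 ↔ y = w 0) (h1 : x ∈ V 1 ↔ y = d)
    (hforth : ∀ z, Sees m x z → z ≠ x → ∃ t, Sees n y t ∧ SameTheory m n V z t)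
    (hback : ∀ t, Sees n y t → t ≠ y → ∃ z, Sees m x z ∧ SameTheory m n V z t) :
    SameTheory m n V x y := by
  intro ψ
  induction ψ with
  | var i =>
    intro h
    have : i = 0 ∨ i = 1 := by simpa [vars] using h
    rcases this with rfl | rfl
    · exact h0.trans mem_val_zero.symm
    · exact h1.trans mem_val_one.symm
  | and φ ψ h₁ h₂ =>
    intro h
    obtain ⟨hφ, hψ⟩ := Finset.union_subset_iff.1 h
    exact and_congr (h₁ hφ) (h₂ hψ)
  | or φ ψ h₁ h₂ =>
    intro h
    obtain ⟨hφ, hψ⟩ := Finset.union_subset_iff.1 h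
    exact or_congr (h₁ hφ) (h₂ hψ)
  | imp φ ψ h₁ h₂ =>
    intro h
    obtain ⟨hφ, hψ⟩ := Finset.union_subset_iff.1 h
    exact imp_congr (h₁ hφ) (h₂ hψ)
  | neg φ h₁ => exact fun h => not_congr (h₁ h)
  | box φ h₁ =>
    intro h
    constructor
    · intro hx t ht
      by_cases hty : t = y
      · exact hty ▸ (h₁ h).1 (hx x (sees_refl m x))
      · obtain ⟨z, hz, hzt⟩ := hback t ht hty
        exact (hzt φ h).1 (hx z hz)
    · intro hy z hz
      by_cases hzx : z = x
      · exact hzx ▸ (h₁ h).2 (hy y (sees_refl n y))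
      · obtain ⟨t, ht, hzt⟩ := hforth z hz hzx
        exact (hzt φ h).2 (hy t ht)

theorem SameTheory.sat_rung_iff {k : ℕ} (h : SameTheory m n V x (w k)) (j : ℕ) :
    (rung j).Sat (Sees m) V x ↔ j = k := by
  rw [h _ (vars_rung j), sat_rung_val]
  simp [eq_comm]

theorem SameTheory.mem_zero_iff (h : SameTheory m n V x y) : x ∈ V 0 ↔ y = w 0 :=
  (h (var 0) (by simp [vars])).trans mem_val_zero

/-- The indices of the rungs that the worlds strictly above `x` look like. -/
def rungsAbove (m n : ℕ) (V : ℕ → Set World.{u}) (x : World.{u}) : Set ℕ :=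
  {k | ∃ z, Sees m x z ∧ z ≠ x ∧ SameTheory m n V z (w k)}

theorem mem_rungsAbove_of_le {k j : ℕ}
    (hsucc : ∀ z, Sees m x z → z ≠ x → z ∉ V 1 → ∃ k, SameTheory m n V z (w k))
    (hk : k ∈ rungsAbove m n V x) (hj : j + 2 ≤ k) : j ∈ rungsAbove m n V x := by
  obtain ⟨z, hz, hzx, hzk⟩ := hk
  have hvars : (dia (and (rung j) (neg (var 1)))).vars ⊆ {0, 1} := by
    simp only [dia, vars, Finset.union_subset_iff, vars_rung]
    simp
  have := (hzk _ hvars).2 (sat_dia.2 ⟨w j, .inr hj, sat_rung_val.2 (.inl rfl), by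
    simp [Sat, mem_val_one]⟩)
  obtain ⟨t, ht, htj, htv⟩ := sat_dia.1 this
  have hxt := sees_trans m _ _ _ hz ht
  have htx : t ≠ x := fun h => hzx (sees_antisymm (h ▸ ht) hz)
  obtain ⟨i, hi⟩ := hsucc t hxt htx htv
  obtain rfl := (hi.sat_rung_iff j).1 htj
  exact ⟨t, hxt, htx, hi⟩

/-- The finite index set is closed under passing from `k` to any `j ≤ k - 2`. It is thus empty, or
an initial segment, or an initial segment with its last-but-one index missing; each shape fits one
rung. -/
theorem exists_sameTheory_of_finite
    (hp : x ∈ V 0 → ∀ z, Sees m x z → z ∈ V 0) (hv : x ∉ V 1)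
    (hsucc : ∀ z, Sees m x z → z ≠ x → ∃ k, SameTheory m n V z (w k))
    (hfin : (rungsAbove m n V x).Finite) : ∃ k, SameTheory m n V x (w k) := by
  set S := rungsAbove m n V x with hS
  have hdown : ∀ k ∈ S, ∀ j, j + 2 ≤ k → j ∈ S := fun k hk j hj =>
    mem_rungsAbove_of_le (fun z hz hzx _ => hsucc z hz hzx) hk hj
  have key : ∀ i, (x ∈ V 0 ↔ i = 0) → (∀ k ∈ S, k = i ∨ k + 2 ≤ i) →
      (∀ k, k + 2 ≤ i → k ∈ S) → SameTheory m n V x (w i) := by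
    intro i hi h₁ h₂
    refine .of_bisim (by simpa using hi) (by simpa using hv) ?_ ?_
    · intro z hz hzx
      obtain ⟨k, hk⟩ := hsucc z hz hzx
      exact ⟨w k, h₁ k ⟨z, hz, hzx, hk⟩, hk⟩
    · intro t ht hti
      cases t with
      | w k =>
        have hki : k + 2 ≤ i := ht.resolve_left fun h => hti (h ▸ rfl)
        obtain ⟨z, hz, -, hzk⟩ := h₂ k hki
        exact ⟨z, hz, hzk⟩
      | d => exact ht.elim
      | r => exact ht.elim
  by_cases hx0 : x ∈ V 0
  · refine ⟨0, key 0 (by simpa using hx0) ?_ (by simp)⟩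
    rintro k ⟨z, hz, -, hzk⟩
    left
    simpa using hzk.mem_zero_iff.1 (hp hx0 z hz)
  by_cases hne : S.Nonempty
  · obtain ⟨k, hk, hmax⟩ : ∃ k ∈ S, ∀ j ∈ S, j ≤ k := by
      obtain ⟨k, hk, h⟩ := hfin.exists_maximalFor id S hne
      exact ⟨k, hk, fun j hj => (le_total j k).elim id fun h' => h hj h'⟩
    by_cases hk1 : ∀ j, j + 1 = k → j ∈ S
    · refine ⟨k + 2, key _ (by simpa using hx0) (fun j hj => ?_) fun j hj => ?_⟩
      · have := hmax j hj
        omega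
      · have : j = k ∨ j + 1 = k ∨ j + 2 ≤ k := by omega
        rcases this with rfl | h | h
        · exact hk
        · exact hk1 j h
        · exact hdown k hk j h
    -- Here the indices are those below `j` together with `j + 1`, so `x` looks like `w (j + 1)`,
    -- just as some world strictly above it does.
    · push Not at hk1
      obtain ⟨j, rfl, hj⟩ := hk1
      refine ⟨j + 1, key _ (by simpa using hx0) (fun i hi => ?_) fun i hi =>
        hdown _ hk i hi⟩
      have := hmax i hi
      have : i ≠ j := fun h => hj (h ▸ hi)
      omega
  · refine ⟨1, key 1 (by simpa using hx0) (fun k hk => absurd ⟨k, hk⟩ hne) ?_⟩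
    omega

/-- A proper world without `p₁` above it looks like a rung of the ladder. -/
theorem exists_sameTheory_rung (x : World.{u}) (hxr : x ≠ r)
    (hp : ∀ y, Sees m x y → y ∈ V 0 → ∀ z, Sees m y z → z ∈ V 0)
    (hv : ∀ y, Sees m x y → y ∉ V 1) : ∃ k, SameTheory m n V x (w k) := by
  induction x using sees_induction (n := m) with
  | h x ih =>
    have hsucc : ∀ z, Sees m x z → z ≠ x → ∃ k, SameTheory m n V z (w k) := by
      intro z hz hzx
      refine ih z hz hzx (fun h => hxr ?_) (fun y hy => hp y (sees_trans m _ _ _ hz hy))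
        fun y hy => hv y (sees_trans m _ _ _ hz hy)
      subst h
      exact eq_r_of_sees_r hz
    refine exists_sameTheory_of_finite (hp x (sees_refl m x)) (hv x (sees_refl m x)) hsucc ?_
    have hsub : rungsAbove m n V x ⊆
        ⋃ z ∈ {z | Sees m x z ∧ z ≠ x}, {k | SameTheory m n V z (w k)} := by
      rintro k ⟨z, hz, hzx, hk⟩
      exact Set.mem_biUnion (show z ∈ {z | Sees m x z ∧ z ≠ x} from ⟨hz, hzx⟩) hk
    refine ((finite_sees m hxr).biUnion fun z _ => Set.Subsingleton.finite ?_).subset hsub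
    intro i hi j hj
    exact (SameTheory.sat_rung_iff hj i).1 ((SameTheory.sat_rung_iff hi i).2 rfl)

/-- If the worlds strictly above `x` look like rungs, and all rungs occur, then `x` is a limit of
the rungs. -/
theorem exists_forall_sat_iff (h0 : x ∉ V 0) (h1 : x ∉ V 1)
    (hsucc : ∀ z, Sees m x z → z ≠ x → ∃ k, SameTheory m n V z (w k))
    (hall : ∀ k, ∃ z, Sees m x z ∧ SameTheory m n V z (w k)) (ψ : Formula) :
    ψ.vars ⊆ {0, 1} → ∃ K, ∀ k, K ≤ k →
      (ψ.Sat (Sees m) V x ↔ ψ.Sat (Sees n) val (w.{u} k)) := by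
  induction ψ with
  | var i =>
    intro h
    have : i = 0 ∨ i = 1 := by simpa [vars] using h
    refine ⟨1, fun k hk => ?_⟩
    rcases this with rfl | rfl
    · simp only [Sat, h0, mem_val_zero, World.w.injEq, false_iff]
      omega
    · simp [Sat, h1, mem_val_one]
  | and φ ψ h₁ h₂ =>
    intro h
    obtain ⟨hφ, hψ⟩ := Finset.union_subset_iff.1 h
    obtain ⟨K, hK⟩ := h₁ hφ
    obtain ⟨L, hL⟩ := h₂ hψ
    exact ⟨max K L, fun k hk => and_congr (hK k (by omega)) (hL k (by omega))⟩
  | or φ ψ h₁ h₂ =>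
    intro h
    obtain ⟨hφ, hψ⟩ := Finset.union_subset_iff.1 h
    obtain ⟨K, hK⟩ := h₁ hφ
    obtain ⟨L, hL⟩ := h₂ hψ
    exact ⟨max K L, fun k hk => or_congr (hK k (by omega)) (hL k (by omega))⟩
  | imp φ ψ h₁ h₂ =>
    intro h
    obtain ⟨hφ, hψ⟩ := Finset.union_subset_iff.1 h
    obtain ⟨K, hK⟩ := h₁ hφ
    obtain ⟨L, hL⟩ := h₂ hψ
    exact ⟨max K L, fun k hk => imp_congr (hK k (by omega)) (hL k (by omega))⟩
  | neg φ h₁ =>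
    intro h
    obtain ⟨K, hK⟩ := h₁ h
    exact ⟨K, fun k hk => not_congr (hK k hk)⟩
  | box φ h₁ =>
    intro h
    have h : φ.vars ⊆ {0, 1} := h
    obtain ⟨K, hK⟩ := h₁ h
    -- A true box transfers to every rung because all rungs occur above `x`. A false one fails at
    -- all late rungs: through the induction hypothesis if the witness is `x`, otherwise because
    -- they see the rung it looks like.
    by_cases hx : φ.box.Sat (Sees m) V x
    · refine ⟨0, fun k _ => iff_of_true hx fun t ht => ?_⟩
      cases t with
      | w j =>
        obtain ⟨z, hz, hzj⟩ := hall j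
        exact (hzj φ h).1 (hx z hz)
      | d => exact ht.elim
      | r => exact ht.elim
    · obtain ⟨z, hz, hzφ⟩ : ∃ z, Sees m x z ∧ ¬ φ.Sat (Sees m) V z := by
        simpa [Sat] using hx
      by_cases hzx : z = x
      · subst hzx
        exact ⟨K, fun k hk => iff_of_false hx fun hbox =>
          hzφ ((hK k hk).2 (hbox _ (sees_refl n _)))⟩
      · obtain ⟨j, hj⟩ := hsucc z hz hzx
        exact ⟨j + 2, fun k hk => iff_of_false hx fun hbox =>
          hzφ ((hj φ h).2 (hbox (w j) (.inr hk)))⟩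

/-- A world without `p₁` above it satisfies the formulas true everywhere in the canonical model. -/
theorem sat_of_forall_not_mem_one
    (hp : ∀ y, Sees m x y → y ∈ V 0 → ∀ z, Sees m y z → z ∈ V 0)
    (hv : ∀ y, Sees m x y → y ∉ V 1) {ψ : Formula} (hψ : ψ.vars ⊆ {0, 1})
    (hval : ∀ y : World.{u}, ψ.Sat (Sees n) val y) : ψ.Sat (Sees m) V x := by
  by_cases hxr : x = r
  · have hsucc : ∀ z, Sees m x z → z ≠ x → ∃ k, SameTheory m n V z (w k) := by
      intro z hz hzx
      exact exists_sameTheory_rung z (fun h => hzx (h.trans hxr.symm))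
        (fun y hy => hp y (sees_trans m _ _ _ hz hy)) fun y hy => hv y (sees_trans m _ _ _ hz hy)
    by_cases hfin : (rungsAbove m n V x).Finite
    · obtain ⟨k, hk⟩ := exists_sameTheory_of_finite (hp x (sees_refl m x)) (hv x (sees_refl m x))
        hsucc hfin
      exact (hk ψ hψ).2 (hval _)
    · have hall : ∀ k, k ∈ rungsAbove m n V x := by
        intro k
        obtain ⟨j, hj, hkj⟩ := Set.Infinite.exists_gt hfin (k + 1)
        exact mem_rungsAbove_of_le (fun z hz hzx _ => hsucc z hz hzx) hj hkj
      have h0 : x ∉ V 0 := by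
        intro h0
        obtain ⟨z, hz, -, hz1⟩ := hall 1
        simpa using hz1.mem_zero_iff.1 (hp x (sees_refl m x) h0 z hz)
      obtain ⟨K, hK⟩ := exists_forall_sat_iff h0 (hv x (sees_refl m x)) hsucc
        (fun k => (hall k).imp fun z hz => ⟨hz.1, hz.2.2⟩) ψ hψ
      exact (hK K le_rfl).2 (hval _)
  · obtain ⟨k, hk⟩ := exists_sameTheory_rung (n := n) x hxr hp hv
    exact (hk ψ hψ).2 (hval _)

/-- Above a world where `ladder n` is necessary, every world with `p₁` looks like the twin `d`. -/
theorem sameTheory_d (x : World.{u}) (hx : ∀ y, Sees m x y → (ladder n).Sat (Sees m) V y)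
    (hv : x ∈ V 1) : SameTheory m n V x d := by
  induction x using sees_induction (n := m) with
  | h x ih =>
    obtain ⟨h0, hpers, ⟨a, ha, haT, hav⟩, ⟨b, hb, hbT, hbv⟩, hn2, hn3⟩ :=
      (sat_ladder.1 (hx x (sees_refl m x))).2.1 hv
    have hsucc : ∀ z, Sees m x z → z ≠ x → z ∉ V 1 → ∃ k, SameTheory m n V z (w k) := by
      intro z hz hzx hzv
      refine exists_sameTheory_rung z (fun h => hzx ?_)
        (fun y hy => (sat_ladder.1 (hx y (sees_trans m _ _ _ hz hy))).1)
        fun y hy => hpers z hz hzv y hy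
      subst h
      exact (eq_r_of_sees_r hz).symm
    have hmem : ∀ k a, Sees m x a → (rung k).Sat (Sees m) V a → a ∉ V 1 →
        k ∈ rungsAbove m n V x := by
      intro k a ha haT hav
      have hax : a ≠ x := fun h => hav (h ▸ hv)
      obtain ⟨i, hi⟩ := hsucc a ha hax hav
      obtain rfl := (hi.sat_rung_iff k).1 haT
      exact ⟨a, ha, hax, hi⟩
    -- Together with the two negative clauses of `ladder n`, this makes the rungs above `x` exactly
    -- those up to `n + 1`, as for `d`; indices from `n + 4` on would bring in `n + 2`.
    have hin : ∀ k, k ≤ n + 1 → k ∈ rungsAbove m n V x := by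
      intro k hk
      have : k = n + 1 ∨ k = n ∨ k + 2 ≤ n + 1 := by omega
      rcases this with rfl | rfl | h
      · exact hmem _ a ha haT hav
      · exact hmem _ b hb hbT hbv
      · exact mem_rungsAbove_of_le hsucc (hmem _ a ha haT hav) h
    refine .of_bisim (by simpa using h0) (by simpa using hv) ?_ ?_
    · intro z hz hzx
      by_cases hzv : z ∈ V 1
      · exact ⟨d, trivial, ih z hz hzx (fun y hy => hx y (sees_trans m _ _ _ hz hy)) hzv⟩
      · obtain ⟨k, hk⟩ := hsucc z hz hzx hzv
        refine ⟨w k, ?_, hk⟩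
        have hnot : ∀ j, (¬ ∃ y, Sees m x y ∧ (rung j).Sat (Sees m) V y ∧ y ∉ V 1) →
            j ∉ rungsAbove m n V x := by
          rintro j hj ⟨t, ht, htx, htj⟩
          refine hj ⟨t, ht, (htj.sat_rung_iff j).2 rfl, fun h => ?_⟩
          have := (htj (var 1) (by simp [vars])).1 h
          simp [Sat, mem_val_one] at this
        by_contra hcon
        have hcon : ¬ k ≤ n + 1 := hcon
        have hkS : k ∈ rungsAbove m n V x := ⟨z, hz, hzx, hk⟩
        have : k = n + 2 ∨ k = n + 3 ∨ n + 2 + 2 ≤ k := by omega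
        rcases this with rfl | rfl | h
        · exact hnot _ hn2 hkS
        · exact hnot _ hn3 hkS
        · exact hnot _ hn2 (mem_rungsAbove_of_le hsucc hkS h)
    · intro t ht htd
      cases t with
      | w k =>
        obtain ⟨z, hz, -, hzk⟩ := hin k ht
        exact ⟨z, hz, hzk⟩
      | d => exact absurd rfl htd
      | r => exact ht.elim

theorem sat_congr {W : Type u} {R : W → W → Prop} {V V' : ℕ → Set W} (h0 : V 0 = V' 0)
    (h1 : V 1 = V' 1) (ψ : Formula) :
    ψ.vars ⊆ {0, 1} → ∀ x, ψ.Sat R V x ↔ ψ.Sat R V' x := by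
  induction ψ with
  | var i =>
    intro h x
    have : i = 0 ∨ i = 1 := by simpa [vars] using h
    rcases this with rfl | rfl <;> simp [Sat, h0, h1]
  | and φ ψ h₁ h₂ =>
    intro h x
    obtain ⟨hφ, hψ⟩ := Finset.union_subset_iff.1 h
    exact and_congr (h₁ hφ x) (h₂ hψ x)
  | or φ ψ h₁ h₂ =>
    intro h x
    obtain ⟨hφ, hψ⟩ := Finset.union_subset_iff.1 h
    exact or_congr (h₁ hφ x) (h₂ hψ x)
  | imp φ ψ h₁ h₂ =>
    intro h x
    obtain ⟨hφ, hψ⟩ := Finset.union_subset_iff.1 h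
    exact imp_congr (h₁ hφ x) (h₂ hψ x)
  | neg φ h₁ => exact fun h x => not_congr (h₁ h x)
  | box φ h₁ => exact fun h x => forall_congr' fun y => imp_congr_right fun _ => h₁ h y

/-- Where `ladder n` is necessary, the formulas true everywhere in the canonical model of the
`n`-th ladder are true. -/
theorem sat_of_box_ladder (hx : ∀ y, Sees m x y → (ladder n).Sat (Sees m) V y) {ψ : Formula}
    (hψ : ψ.vars ⊆ {0, 1}) (hval : ∀ y : World.{u}, ψ.Sat (Sees n) val y) :
    ψ.Sat (Sees m) V x := by
  by_cases hv : x ∈ V 1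
  · exact (sameTheory_d x hx hv ψ hψ).2 (hval d)
  by_cases hq : root.Sat (Sees m) V x
  · obtain ⟨rfl, h0, h1⟩ := eq_of_sat_root hx hq
    exact (sat_congr h0 h1 ψ hψ x).2 (hval x)
  · refine sat_of_forall_not_mem_one (fun y hy => (sat_ladder.1 (hx y hy)).1) ?_ hψ hval
    intro y hy hyv
    exact hq (sat_root.2 ⟨hv, y, hy, hyv⟩)

end Formula

end InteriorAlgebra

namespace InteriorAlgebra

open World

/-! ### Subalgebras of definable elements -/

/-- The elements of `𝔅` that are values of formulas in the variables of `P` under `ν`. -/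
def definable (𝔅 : Alg.{u}) (P : Finset ℕ) (ν : ℕ → 𝔅) (hP : P.Nonempty) :
    BooleanSubalgebra 𝔅 where
  carrier := {a | ∃ φ : Formula, φ.vars ⊆ P ∧ φ.eval ν = a}
  supClosed' := by
    rintro _ ⟨φ, hφ, rfl⟩ _ ⟨ψ, hψ, rfl⟩
    exact ⟨.or φ ψ, Finset.union_subset hφ hψ, rfl⟩
  infClosed' := by
    rintro _ ⟨φ, hφ, rfl⟩ _ ⟨ψ, hψ, rfl⟩
    exact ⟨.and φ ψ, Finset.union_subset hφ hψ, rfl⟩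
  compl_mem' := by
    rintro _ ⟨φ, hφ, rfl⟩
    exact ⟨.neg φ, hφ, rfl⟩
  bot_mem' := by
    -- The language has no constants, so `⊥` needs a variable.
    obtain ⟨i, hi⟩ := hP
    refine ⟨.and (.var i) (.neg (.var i)), ?_, by simp [Formula.eval]⟩
    simpa [Formula.vars] using hi

/-- The subalgebra of `𝔅` generated by the values of the variables of `P` under `ν`. -/
def definableAlgebra (𝔅 : Alg.{u}) (P : Finset ℕ) (ν : ℕ → 𝔅) (hP : P.Nonempty) : Alg.{u} where
  carrier := definable 𝔅 P ν hP
  str :=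
    { (inferInstance : BooleanAlgebra (definable 𝔅 P ν hP)) with
      box := fun a => ⟨box a.1, by
        obtain ⟨φ, hφ, h⟩ := a.2
        exact ⟨.box φ, hφ, congrArg box h⟩⟩
      box_top := Subtype.ext box_top
      box_inf := fun a b => Subtype.ext (box_inf a.1 b.1)
      box_le := fun a => box_le a.1
      box_le_box_box := fun a => box_le_box_box a.1 }

section definableAlgebra

variable {𝔅 : Alg.{u}} {P : Finset ℕ} {ν : ℕ → 𝔅} {hP : P.Nonempty}

theorem val_eval (f : ℕ → definableAlgebra 𝔅 P ν hP) (φ : Formula) :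
    (φ.eval f).1 = φ.eval fun i => (f i).1 := by
  induction φ with
  | var i => rfl
  | and φ ψ h₁ h₂ => exact congrArg₂ (· ⊓ ·) h₁ h₂
  | or φ ψ h₁ h₂ => exact congrArg₂ (· ⊔ ·) h₁ h₂
  | imp φ ψ h₁ h₂ => exact congrArg₂ (· ⇨ ·) h₁ h₂
  | neg φ h₁ => exact congrArg compl h₁
  | box φ h₁ => exact congrArg box h₁

theorem Valid.definableAlgebra {φ : Formula} (h : Valid 𝔅 φ) :
    Valid (definableAlgebra 𝔅 P ν hP) φ := fun f =>
  Subtype.ext ((val_eval f φ).trans (h _))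

theorem generates_definableAlgebra (f : ℕ → definableAlgebra 𝔅 P ν hP)
    (hf : ∀ i, (f i).1 = ν i) : Generates (f '' (P : Set ℕ)) := by
  intro S hS hfS
  have hfν : (fun i => (f i).1) = ν := funext hf
  have key : ∀ φ : Formula, φ.vars ⊆ P → φ.eval f ∈ S := by
    intro φ
    induction φ with
    | var i => exact fun h => hfS ⟨i, by simpa [Formula.vars] using h, rfl⟩
    | and φ ψ h₁ h₂ =>
      intro h
      obtain ⟨hφ, hψ⟩ := Finset.union_subset_iff.1 h
      exact hS.inf _ (h₁ hφ) _ (h₂ hψ)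
    | or φ ψ h₁ h₂ =>
      intro h
      obtain ⟨hφ, hψ⟩ := Finset.union_subset_iff.1 h
      exact hS.sup _ (h₁ hφ) _ (h₂ hψ)
    | imp φ ψ h₁ h₂ =>
      intro h
      obtain ⟨hφ, hψ⟩ := Finset.union_subset_iff.1 h
      exact hS.himp _ (h₁ hφ) _ (h₂ hψ)
    | neg φ h₁ => exact fun h => hS.compl _ (h₁ h)
    | box φ h₁ => exact fun h => hS.box _ (h₁ h)
  refine Set.eq_univ_of_forall fun a => ?_
  obtain ⟨φ, hφ, h⟩ := a.2
  have : φ.eval f = a := Subtype.ext (by rw [val_eval, hfν, h])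
  exact this ▸ key φ hφ

end definableAlgebra

/-! ### The algebras of the ladders -/

/-- The algebra of all subsets of the `n`-th ladder. -/
def ladderFrame (n : ℕ) : Alg.{u} := complexAlgebra (Sees.{u} n) (sees_refl n) (sees_trans n)

/-- The variety generated by the algebras of all subsets of the ladders. -/
def ladderVariety : Set Alg.{u} := Mod {θ | ∀ m, Valid (ladderFrame.{u} m) θ}

/-- The algebra of definable subsets of the `n`-th ladder. -/
def ladderAlgebra (n : ℕ) : Alg.{u} :=
  definableAlgebra (ladderFrame n) {0, 1} val (Finset.insert_nonempty 0 {1})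

/-- The canonical valuation in `ladderAlgebra n`. -/
def ladderVal (n i : ℕ) : ladderAlgebra.{u} n :=
  ⟨val i, if i = 1 then .var 1 else .var 0, by split_ifs <;> simp [Formula.vars], by
    split_ifs with h
    · rw [h]; rfl
    · simp only [Formula.eval, val, h]; rfl⟩

/-- The characteristic formula of `ladderAlgebra n`. -/
def ladderFormula (n : ℕ) : Formula := (Formula.ladder n).boxImp (.neg Formula.root)

/-- The set of worlds that an element of `ladderAlgebra n` is. -/
def worlds {n : ℕ} (a : ladderAlgebra.{u} n) : Set World.{u} := a.1

theorem worlds_injective {n : ℕ} : Function.Injective (worlds.{u} (n := n)) :=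
  Subtype.val_injective

theorem mem_worlds_eval {n : ℕ} {φ : Formula} {x : World.{u}} :
    x ∈ worlds (φ.eval (ladderVal.{u} n)) ↔ φ.Sat (Sees n) val x :=
  Set.ext_iff.1
    ((val_eval _ φ).trans (eval_complexAlgebra (sees_refl n) (sees_trans n) val φ)) x

theorem eq_top_iff_forall_mem_worlds {n : ℕ} {a : ladderAlgebra.{u} n} :
    a = ⊤ ↔ ∀ x, x ∈ worlds a :=
  worlds_injective.eq_iff.symm.trans Set.eq_univ_iff_forall

theorem eval_ladderVal_eq_top {n : ℕ} {φ : Formula} :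
    φ.eval (ladderVal.{u} n) = ⊤ ↔ ∀ x : World.{u}, φ.Sat (Sees n) val x :=
  eq_top_iff_forall_mem_worlds.trans (forall_congr' fun _ => mem_worlds_eval)

theorem ladderAlgebra_mem (n : ℕ) : ladderAlgebra.{u} n ∈ ladderVariety.{u} :=
  fun _ hθ => (hθ n).definableAlgebra

theorem isOpremum_ladder (n : ℕ) :
    IsOpremum (Formula.eval (ladderVal.{u} n) (.neg Formula.root)) := by
  set b := Formula.eval (ladderVal.{u} n) (.neg Formula.root)
  have hb : ∀ x, x ∈ worlds b ↔ x ≠ r := fun x =>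
    mem_worlds_eval.trans (not_congr Formula.sat_root_val)
  refine ⟨⟨le_antisymm (box_le b) fun x hx y hy => ?_, fun h => ?_⟩, ?_⟩
  · refine (hb y).2 fun h => (hb x).1 hx ?_
    subst h
    exact eq_r_of_sees_r hy
  · exact (hb r).1 (eq_top_iff_forall_mem_worlds.1 h r) rfl
  · rintro a ⟨ha, hat⟩ x hx
    refine (hb x).2 fun h => hat ?_
    subst h
    have hr : r ∈ worlds (box a) := by
      rw [ha]
      exact hx
    exact eq_top_iff_forall_mem_worlds.2 fun y => hr y trivial

theorem valid_ladderFrame_boxImp {m n : ℕ} {ψ : Formula} (hψ : ψ.vars ⊆ {0, 1})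
    (h : ∀ x : World.{u}, ψ.Sat (Sees n) val x) :
    Valid (ladderFrame.{u} m) ((Formula.ladder n).boxImp ψ) := by
  refine valid_complexAlgebra.2 fun V x hx y hy => ?_
  exact Formula.sat_of_box_ladder (fun z hz => hx z (sees_trans m _ _ _ hy hz)) hψ h

theorem isCharacteristicFormula_ladder (n : ℕ) :
    IsCharacteristicFormula ladderVariety.{u} (ladderAlgebra n) (ladderFormula n) := by
  refine ⟨ladderAlgebra_mem n, (isOpremum_ladder n).isSubdirectlyIrreducible, {0, 1},
    Formula.ladder n, .neg Formula.root, ladderVal n, ⟨Formula.vars_ladder n, ?_, ?_, ?_⟩,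
    Formula.vars_root, isOpremum_ladder n, rfl⟩
  · exact generates_definableAlgebra _ fun _ => rfl
  · exact eval_ladderVal_eq_top.2 (Formula.sat_ladder_val n)
  · intro ψ hψ hval 𝔅 hB
    -- It suffices to check the generating frames, since `ladderVariety` is the class of models of
    -- their common theory.
    exact hB _ fun m => valid_ladderFrame_boxImp hψ (eval_ladderVal_eq_top.1 hval)

theorem infinite_ladderAlgebra (n : ℕ) : Infinite (ladderAlgebra.{u} n) := by
  refine Infinite.of_injective (fun k => (Formula.rung k).eval (ladderVal.{u} n)) ?_
  intro j k h
  have h' := Set.ext_iff.1 (congrArg worlds h) (w j)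
  simp only [mem_worlds_eval, Formula.sat_rung_val] at h'
  simpa using h'

theorem valid_ladderFormula {m n : ℕ} (h : m ≠ n) :
    Valid (ladderAlgebra.{u} m) (ladderFormula n) := by
  refine Valid.definableAlgebra (valid_complexAlgebra.2 fun V x hx y hy hq => h ?_)
  exact (Formula.eq_of_sat_root (fun z hz => hx z (sees_trans m _ _ _ hy hz)) hq).1

/-! ### The number of varieties -/

/-- An injective numbering of the formulas. -/
def Formula.code : Formula → ℕ
  | .var i => Nat.pair 0 i
  | .and φ ψ => Nat.pair 1 (Nat.pair φ.code ψ.code)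
  | .or φ ψ => Nat.pair 2 (Nat.pair φ.code ψ.code)
  | .imp φ ψ => Nat.pair 3 (Nat.pair φ.code ψ.code)
  | .neg φ => Nat.pair 4 φ.code
  | .box φ => Nat.pair 5 φ.code

theorem Formula.code_injective : Function.Injective Formula.code := by
  intro φ
  induction φ with
  | var i => intro ψ h; cases ψ <;> simp_all [Formula.code]
  | and φ₁ φ₂ h₁ h₂ =>
    intro ψ h
    cases ψ <;> simp [Formula.code] at h
    rw [h₁ h.1, h₂ h.2]
  | or φ₁ φ₂ h₁ h₂ =>
    intro ψ h
    cases ψ <;> simp [Formula.code] at h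
    rw [h₁ h.1, h₂ h.2]
  | imp φ₁ φ₂ h₁ h₂ =>
    intro ψ h
    cases ψ <;> simp [Formula.code] at h
    rw [h₁ h.1, h₂ h.2]
  | neg φ h₁ =>
    intro ψ h
    cases ψ <;> simp [Formula.code] at h
    rw [h₁ h]
  | box φ h₁ =>
    intro ψ h
    cases ψ <;> simp [Formula.code] at h
    rw [h₁ h]

theorem mk_isVariety_le : Cardinal.mk {V : Set Alg.{u} | IsVariety V} ≤ Cardinal.continuum := by
  have hF : Cardinal.mk (Set Formula) ≤ Cardinal.continuum := by
    rw [← Cardinal.mk_set_nat]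
    exact Cardinal.mk_le_of_injective (Set.image_injective.2 Formula.code_injective)
  have hsurj : Function.Surjective
      (fun Γ : Set Formula => (⟨Mod Γ, Γ, rfl⟩ : {V : Set Alg.{u} | IsVariety V})) := by
    rintro ⟨_, Γ, rfl⟩
    exact ⟨Γ, rfl⟩
  have h := Cardinal.lift_mk_le_lift_mk_of_surjective hsurj
  rw [Cardinal.lift_uzero] at h
  exact h.trans (Cardinal.lift_le_continuum.2 hF)

/-- The ladder formulas with index `0` and with the indices `i + 1`, `i ∈ S`. -/
def ladderFormulas (S : Set ℕ) : Set Formula := ladderFormula '' insert 0 (Nat.succ '' S)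

theorem ladderAlgebra_mem_Mod {S : Set ℕ} {i : ℕ} :
    ladderAlgebra.{u} (i + 1) ∈ Mod (ladderFormulas S) ↔ i ∉ S := by
  constructor
  · intro h hi
    exact (isCharacteristicFormula_ladder (i + 1)).not_valid
      (h _ ⟨i + 1, .inr ⟨i, hi, rfl⟩, rfl⟩)
  · rintro hi _ ⟨j, hj, rfl⟩
    apply valid_ladderFormula
    rintro rfl
    rcases hj with hj | ⟨j, hj, hji⟩
    · omega
    · exact hi (Nat.succ_injective hji ▸ hj)

theorem Mod_ladderFormulas_injective :
    Function.Injective fun S => Mod.{u} (ladderFormulas S) := by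
  intro S T h
  have h : Mod.{u} (ladderFormulas S) = Mod (ladderFormulas T) := h
  ext i
  rw [← not_iff_not, ← ladderAlgebra_mem_Mod.{u}, h, ladderAlgebra_mem_Mod]

end InteriorAlgebra

theorem theorem7p5 :
    ∃ M : Set InteriorAlgebra.Alg.{u}, InteriorAlgebra.IsVariety M ∧
      Cardinal.mk {V : Set InteriorAlgebra.Alg.{u} |
        InteriorAlgebra.IsVariety V ∧
        InteriorAlgebra.DefinedByCharacteristicFormulas M V ∧
        ¬ InteriorAlgebra.AxiomatizedByJankovFormulas V} = Cardinal.continuum := by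
  open InteriorAlgebra in
  have hM : IsVariety ladderVariety.{u} := ⟨_, rfl⟩
  refine ⟨ladderVariety, hM, le_antisymm ?_ ?_⟩
  · exact (Cardinal.mk_le_mk_of_subset fun V hV => hV.1).trans mk_isVariety_le
  · have hchar : ∀ S, ∀ χ ∈ ladderFormulas S,
        ∃ 𝔄 : Alg.{u}, Infinite 𝔄 ∧ IsCharacteristicFormula ladderVariety 𝔄 χ := by
      rintro S _ ⟨n, -, rfl⟩
      exact ⟨_, infinite_ladderAlgebra n, isCharacteristicFormula_ladder n⟩
    -- The index `0` keeps the set of formulas nonempty even for empty `S`; the class of all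
    -- interior algebras is axiomatized by the empty set of Jankov formulas.
    let F : Set ℕ → {V : Set Alg.{u} | IsVariety V ∧
        DefinedByCharacteristicFormulas ladderVariety V ∧ ¬ AxiomatizedByJankovFormulas V} :=
      fun S => ⟨Mod (ladderFormulas S), ⟨_, rfl⟩, ⟨_, hchar S, rfl⟩,
        not_axiomatizedByJankovFormulas hM (hchar S) ⟨_, 0, .inl rfl, rfl⟩⟩
    have hF : Function.Injective F := fun S T h =>
      Mod_ladderFormulas_injective (congrArg Subtype.val h)
    have h := Cardinal.lift_mk_le_lift_mk_of_injective hF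
    rw [Cardinal.mk_set_nat, Cardinal.lift_continuum, Cardinal.lift_uzero] at h
    exact h
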